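/- There is an absolute constant $K>0$ such that the following holds. Let $\mathbb{F}$ be any field, let $d\ge 1$ and $n$ be integers, let $c>0$ be real, and let the variables be partitioned into $d$ blocks $\mathbf{x}=\mathbf{x}_1\sqcup\cdots\sqcup\mathbf{x}_d$ with $|\mathbf{x}_i|=n$ for all $i$. If a set-multilinear formula $\Phi$ over $\mathbb{F}$ of size $s\le n^c$ computes a polynomial $f(\mathbf{x}_1,\dots,\mathbf{x}_d)$ that is set-multilinear with respect to this partition, then $$\operatorname{TensorRank}(f)\;\le\;\frac{n^d}{n^{\,d/2^{Kc}}}.$$ Here a formula is a tree whose leaves are labelled by field constants or variables and whose internal nodes are sum gates (which may scale their inputs by field constants) and product gates of arbitrary fan-in; its size is the number of its nodes. It is set-multilinear if the children of each sum gate have the same syntactic degree (possibly over different sets of blocks) and the children of each product gate use variables from pairwise disjoint sets of blocks. A polynomial is set-multilinear with respect to $\mathbf{x}_1\sqcup\cdots\sqcup\mathbf{x}_d$ if each of its monomials contains exactly one variable (counted with multiplicity) from each block. $\operatorname{TensorRank}(f)$ is the least $r$ such that $f=\sum_{k=1}^r \ell_{k1}(\mathbf{x}_1)\cdots\ell_{kd}(\mathbf{x}_d)$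 with each $\ell_{ki}(\mathbf{x}_i)$ a linear form in the variables of $\mathbf{x}_i$. -/

import Mathlib

universe u

/-- Arithmetic formulas over the field `F` in the variables `x_{i,j}` (`i < d`, `j < n`): the
`i`-th block `x_i` consists of the `n` variables `x_{i,0}, …, x_{i,n-1}`.  A formula is a tree
with leaves labelled by field constants or variables and with sum and product gates of arbitrary
fan-in.  A sum gate may scale each of its inputs by a field constant (a label on the wire). -/
inductive ArithFormula (F : Type u) (d n : ℕ) : Type u
  | const (a : F) : ArithFormula F d n
  | var (i : Fin d) (j : Fin n) : ArithFormula F d n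
  | sum (k : ℕ) (w : Fin k → F) (child : Fin k → ArithFormula F d n) : ArithFormula F d n
  | prod (k : ℕ) (child : Fin k → ArithFormula F d n) : ArithFormula F d n

namespace ArithFormula

variable {F : Type u} {d n : ℕ}

/-- The size of a formula: the number of its nodes (leaves and gates). -/
def size : ArithFormula F d n → ℕ
  | const _ => 1
  | var _ _ => 1
  | sum _ _ child => 1 + ∑ l, (child l).size
  | prod _ child => 1 + ∑ l, (child l).size

/-- The polynomial computed by a formula. -/
noncomputable def eval [Field F] : ArithFormula F d n → MvPolynomial (Fin d × Fin n) F
  | const a => MvPolynomial.C a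
  | var i j => MvPolynomial.X (i, j)
  | sum _ w child => ∑ l, MvPolynomial.C (w l) * (child l).eval
  | prod _ child => ∏ l, (child l).eval

/-- The set of (indices of) blocks from which a variable occurs in the formula. -/
def blocks : ArithFormula F d n → Finset (Fin d)
  | const _ => ∅
  | var i _ => {i}
  | sum _ _ child => Finset.univ.biUnion fun l => (child l).blocks
  | prod _ child => Finset.univ.biUnion fun l => (child l).blocks

/-- The syntactic degree of a formula. -/
def degree : ArithFormula F d n → ℕ
  | const _ => 0
  | var _ _ => 1
  | sum _ _ child => Finset.univ.sup fun l => (child l).degree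
  | prod _ child => ∑ l, (child l).degree

/-- (Syntactically) set-multilinear formulas, with respect to the blocks `x_1, …, x_d`: the children
of each sum gate have the same degree, possibly over different sets of blocks, and the children of
each product gate use pairwise disjoint sets of blocks.

If the output has degree `d` then it follows, from the output downwards, that the children of every
sum gate use the same blocks, and that every gate computes a polynomial each of whose monomials has
exactly one variable from each block below that gate. -/
def IsSetMultilinear : ArithFormula F d n → Prop
  | const _ => True
  | var _ _ => True
  | sum _ _ child => (∀ l, (child l).IsSetMultilinear) ∧
      ∀ l l', (child l).degree = (child l').degree
  | prod _ child => (∀ l, (child l).IsSetMultilinear) ∧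
      ∀ l l', l ≠ l' → Disjoint (child l).blocks (child l').blocks

end ArithFormula

namespace SetMultilinear

variable {F : Type u} [Field F] {d n : ℕ}

/-- A polynomial is set-multilinear with respect to `x_1 ⊔ ⋯ ⊔ x_d` if each of its monomials
has exactly one variable (counted with multiplicity) from each block. -/
def IsSetMultilinearPoly (f : MvPolynomial (Fin d × Fin n) F) : Prop :=
  ∀ m ∈ f.support, ∀ i : Fin d, ∑ j : Fin n, m (i, j) = 1

/-- The linear form `∑_j a_j x_{i,j}` in the variables of the `i`-th block. -/
noncomputable def linForm (i : Fin d) (a : Fin n → F) : MvPolynomial (Fin d × Fin n) F :=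
  ∑ j, MvPolynomial.C (a j) * MvPolynomial.X (i, j)

/-- `f` is a sum of `r` products `ℓ_1(x_1) ⋯ ℓ_d(x_d)` of linear forms, one in each block. -/
def HasDecomposition (f : MvPolynomial (Fin d × Fin n) F) (r : ℕ) : Prop :=
  ∃ a : Fin r → Fin d → Fin n → F, f = ∑ k, ∏ i, linForm i (a k i)

/-- The tensor rank of `f`: the least `r` such that `f` is a sum of `r` products of linear forms,
one in each block. -/
noncomputable def tensorRank (f : MvPolynomial (Fin d × Fin n) F) : ℕ :=
  sInf {r | HasDecomposition f r}

/-- For `d ≥ 1`, the set in the definition of the tensor rank of a set-multilinear polynomial is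
not empty, so that the tensor rank is the length of an actual decomposition. -/
theorem hasDecomposition_tensorRank (hd : 0 < d) (f : MvPolynomial (Fin d × Fin n) F)
    (hf : IsSetMultilinearPoly f) : HasDecomposition f (tensorRank f) := by
  classical
  apply Nat.sInf_mem (s := {r | HasDecomposition f r})
  have key : ∀ m ∈ f.support, ∃ a : Fin d → Fin n → F,
      MvPolynomial.monomial m (f.coeff m) = ∏ i, linForm i (a i) := by
    intro m hm
    have h1 : ∀ i : Fin d, ∃ j : Fin n, ∀ j', m (i, j') = if j' = j then 1 else 0 := by
      intro i
      have h := hf m hm i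
      have : ∃ j, m (i, j) ≠ 0 := by
        by_contra! h0
        simp [h0] at h
      obtain ⟨j, hj⟩ := this
      refine ⟨j, fun j' => ?_⟩
      rw [← Finset.add_sum_erase _ _ (Finset.mem_univ j)] at h
      split_ifs with hjj
      · subst hjj; omega
      · have hle : m (i, j') ≤ ∑ x ∈ Finset.univ.erase j, m (i, x) :=
          Finset.single_le_sum (f := fun x => m (i, x)) (fun _ _ => Nat.zero_le _)
            (Finset.mem_erase.2 ⟨hjj, Finset.mem_univ _⟩)
        omega
    choose g hg using h1
    refine ⟨fun i j => if j = g i then (if i = ⟨0, hd⟩ then f.coeff m else 1) else 0, ?_⟩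
    have h2 : ∀ i : Fin d, linForm i
        (fun j => if j = g i then (if i = ⟨0, hd⟩ then f.coeff m else 1) else (0 : F))
        = MvPolynomial.C (if i = ⟨0, hd⟩ then f.coeff m else 1) * MvPolynomial.X (i, g i) := by
      intro i
      unfold linForm
      rw [Finset.sum_eq_single (g i)]
      · simp
      · intro b _ hb; simp [hb]
      · intro h; exact absurd (Finset.mem_univ _) h
    rw [Finset.prod_congr rfl fun i _ => h2 i, Finset.prod_mul_distrib, ← map_prod,
      Finset.prod_ite_eq' Finset.univ, if_pos (Finset.mem_univ _), MvPolynomial.monomial_eq,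
      Finsupp.prod_fintype _ _ (fun _ => pow_zero _), Fintype.prod_prod_type]
    congr 1
    refine Finset.prod_congr rfl fun i _ => ?_
    rw [Finset.prod_eq_single (g i)]
    · simp [hg]
    · intro b _ hb; simp [hg, hb]
    · intro h; exact absurd (Finset.mem_univ _) h
  choose! a ha using key
  refine ⟨f.support.card, fun k => a (f.support.equivFin.symm k), ?_⟩
  calc f = ∑ m ∈ f.support, MvPolynomial.monomial m (f.coeff m) := f.as_sum
    _ = ∑ m ∈ f.support, ∏ i, linForm i (a m i) := Finset.sum_congr rfl ha
    _ = ∑ m : f.support, ∏ i, linForm i (a m i) :=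
        (Finset.sum_coe_sort f.support fun m => ∏ i, linForm i (a m i)).symm
    _ = _ := (Equiv.sum_comp f.support.equivFin.symm
        fun m : f.support => ∏ i, linForm i (a m i)).symm

end SetMultilinear

/-! Write `b` for the number of blocks below a gate and `s` for the size of its subformula. Any
polynomial multilinear in `b ≥ 1` blocks has rank at most `n ^ (b - 1)`, and the aim is to save more
factors of `n`. For size at most `n ^ m`, three bounds on the rank are proved together by induction
on the formula: `s ^ b`; a saving of `n ^ (1 + log₂ b)` from `s * n ^ b`; and, for `b ≥ D = 2 ^ (m +
1)`, a saving of `n ^ (⌈b / D⌉ + m)`.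

Sum gates add ranks and sizes. At a product of two factors, a factor bounded trivially contributes
one saved `n` and its size is not charged; this drives the logarithmic bound and the case of one
small factor. Two large factors are charged the product of their sizes, and the surplus `n ^ m`
absorbs the second. The logarithmic bound starts the linear one, when two factors below `D` first
reach `D` blocks.

At the output the surplus `n ^ m` cancels the size, leaving a saving of `n ^ ⌈d / D⌉`. Taking `m =
⌈c⌉` settles `c ≥ 1/2`; for smaller `c` this saving is too weak, and `s ^ d` is used instead. -/

namespace SetMultilinear

variable {F : Type u} [Field F] {d n : ℕ}

/-! ### Rank relative to a set of blocks -/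

/-- `f` is a linear combination of `r` products of linear forms, one in each block of `B`. -/
def HasRankLE (B : Finset (Fin d)) (r : ℕ) (f : MvPolynomial (Fin d × Fin n) F) : Prop :=
  ∃ (w : Fin r → F) (a : Fin r → Fin d → Fin n → F),
    f = ∑ k, MvPolynomial.C (w k) * ∏ i ∈ B, linForm i (a k i)

namespace HasRankLE

variable {B B₁ B₂ : Finset (Fin d)} {r r₁ r₂ : ℕ} {f g : MvPolynomial (Fin d × Fin n) F}

theorem of_fintype {ι : Type*} [Fintype ι] (w : ι → F) (a : ι → Fin d → Fin n → F)
    (hr : Fintype.card ι = r)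
    (hf : f = ∑ k, MvPolynomial.C (w k) * ∏ i ∈ B, linForm i (a k i)) : HasRankLE B r f := by
  subst hr
  let e := Fintype.equivFin ι
  refine ⟨fun k => w (e.symm k), fun k => a (e.symm k), hf.trans ?_⟩
  exact (Equiv.sum_comp e.symm
    fun k => MvPolynomial.C (w k) * ∏ i ∈ B, linForm i (a k i)).symm

theorem zero (B : Finset (Fin d)) : HasRankLE B 0 (0 : MvPolynomial (Fin d × Fin n) F) :=
  ⟨fun _ => 0, fun _ _ _ => 0, by simp⟩

theorem add (hf : HasRankLE B r₁ f) (hg : HasRankLE B r₂ g) : HasRankLE B (r₁ + r₂) (f + g) := by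
  obtain ⟨w, a, rfl⟩ := hf
  obtain ⟨v, b, rfl⟩ := hg
  exact of_fintype (ι := Fin r₁ ⊕ Fin r₂) (Sum.elim w v) (Sum.elim a b) (by simp) (by simp)

theorem mono (hf : HasRankLE B r₁ f) (h : r₁ ≤ r₂) : HasRankLE B r₂ f := by
  obtain ⟨k, rfl⟩ := Nat.exists_eq_add_of_le h
  have h0 : HasRankLE B k (0 : MvPolynomial (Fin d × Fin n) F) :=
    ⟨fun _ => 0, fun _ _ _ => 0, by simp⟩
  simpa using hf.add h0

theorem C_mul (hf : HasRankLE B r f) (c : F) : HasRankLE B r (MvPolynomial.C c * f) := by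
  obtain ⟨w, a, rfl⟩ := hf
  exact ⟨fun k => c * w k, a, by simp [Finset.mul_sum, mul_assoc]⟩

theorem mul (hB : Disjoint B₁ B₂) (hf : HasRankLE B₁ r₁ f) (hg : HasRankLE B₂ r₂ g) :
    HasRankLE (B₁ ∪ B₂) (r₁ * r₂) (f * g) := by
  obtain ⟨w, a, rfl⟩ := hf
  obtain ⟨v, b, rfl⟩ := hg
  refine of_fintype (ι := Fin r₁ × Fin r₂) (fun k => w k.1 * v k.2)
    (fun k i => if i ∈ B₁ then a k.1 i else b k.2 i) (by simp) ?_
  rw [Finset.sum_mul_sum, Fintype.sum_prod_type]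
  refine Finset.sum_congr rfl fun k _ => Finset.sum_congr rfl fun l _ => ?_
  rw [Finset.prod_union hB]
  have h1 : ∏ i ∈ B₁, linForm i (if i ∈ B₁ then a k i else b l i) = ∏ i ∈ B₁, linForm i (a k i) :=
    Finset.prod_congr rfl fun i hi => by rw [if_pos hi]
  have h2 : ∏ i ∈ B₂, linForm i (if i ∈ B₁ then a k i else b l i) = ∏ i ∈ B₂, linForm i (b l i) :=
    Finset.prod_congr rfl fun i hi => by rw [if_neg (Finset.disjoint_right.1 hB hi)]
  rw [h1, h2, map_mul]
  ring

theorem const (c : F) : HasRankLE ∅ 1 (MvPolynomial.C c : MvPolynomial (Fin d × Fin n) F) :=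
  ⟨fun _ => c, fun _ _ _ => 0, by simp⟩

theorem var (i : Fin d) (j : Fin n) :
    HasRankLE {i} 1 (MvPolynomial.X (i, j) : MvPolynomial (Fin d × Fin n) F) :=
  ⟨fun _ => 1, fun _ _ => Pi.single j 1, by simp [linForm, Pi.single_apply]⟩

/-- Expanding all linear forms but those in one block. -/
theorem trivial_bound (hf : HasRankLE B r f) : HasRankLE B (n ^ (B.card - 1)) f := by
  classical
  obtain ⟨w, a, rfl⟩ := hf
  rcases B.eq_empty_or_nonempty with rfl | ⟨i₀, hi₀⟩
  -- With no blocks the truncated exponent `0 - 1` gives `n ^ 0 = 1`, which is the right bound for a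
  -- constant.
  · simpa using const (d := d) (n := n) (∑ k, w k)
  obtain ⟨A, hA, rfl⟩ : ∃ A, i₀ ∉ A ∧ B = insert i₀ A :=
    ⟨B.erase i₀, Finset.notMem_erase _ _, (Finset.insert_erase hi₀).symm⟩
  refine of_fintype (ι := A → Fin n) (fun _ => 1)
    (fun p i => if h : i ∈ A then Pi.single (p ⟨i, h⟩) 1
      else fun j => ∑ k, w k * (∏ l : A, a k l (p l)) * a k i₀ j) ?_ ?_
  · simp [Finset.card_insert_of_notMem hA]
  have expand : ∀ k, ∏ i ∈ A, linForm i (a k i) =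
      ∑ p : A → Fin n, MvPolynomial.C (∏ l : A, a k l (p l)) *
        ∏ l : A, (MvPolynomial.X ((l : Fin d), p l) : MvPolynomial (Fin d × Fin n) F) := by
    intro k
    rw [← Finset.prod_coe_sort A fun i => linForm i (a k i)]
    simp only [linForm]
    rw [Finset.prod_univ_sum, Fintype.piFinset_univ]
    exact Finset.sum_congr rfl fun p _ => by rw [Finset.prod_mul_distrib, map_prod]
  have forms : ∀ p : A → Fin n, ∏ i ∈ A, linForm i (if h : i ∈ A then Pi.single (p ⟨i, h⟩) 1
      else fun j => ∑ k, w k * (∏ l : A, a k l (p l)) * a k i₀ j) =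
      ∏ l : A, (MvPolynomial.X ((l : Fin d), p l) : MvPolynomial (Fin d × Fin n) F) := by
    intro p
    rw [← Finset.prod_coe_sort A]
    refine Finset.prod_congr rfl fun l _ => ?_
    simp [linForm, Pi.single_apply]
  simp_rw [Finset.prod_insert hA, forms, dif_neg hA, expand]
  simp only [linForm, map_sum, map_mul, map_one, one_mul, Finset.mul_sum, Finset.sum_mul]
  rw [Finset.sum_comm]
  refine Finset.sum_congr rfl fun p _ => ?_
  rw [Finset.sum_comm' (t' := Finset.univ) (s' := fun _ => Finset.univ) (by simp)]
  refine Finset.sum_congr rfl fun k _ => Finset.sum_congr rfl fun j _ => ?_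
  ring

theorem hasDecomposition (hd : 0 < d) (hf : HasRankLE Finset.univ r f) :
    HasDecomposition f r := by
  obtain ⟨w, a, rfl⟩ := hf
  refine ⟨fun k i j => (if i = ⟨0, hd⟩ then w k else 1) * a k i j,
    Finset.sum_congr rfl fun k _ => ?_⟩
  have h : ∀ i : Fin d, linForm i (fun j => (if i = ⟨0, hd⟩ then w k else 1) * a k i j) =
      MvPolynomial.C (if i = ⟨0, hd⟩ then w k else 1) * linForm i (a k i) := by
    intro i
    simp only [linForm, Finset.mul_sum, map_mul, mul_assoc]
  rw [Finset.prod_congr rfl fun i _ => h i, Finset.prod_mul_distrib, ← map_prod]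
  simp

theorem tensorRank_le (hd : 0 < d) (hf : HasRankLE Finset.univ r f) : tensorRank f ≤ r :=
  Nat.sInf_le (hf.hasDecomposition hd)

end HasRankLE

/-! ### The three rank bounds under sums and products -/

/-- The bounds on the rank, over the blocks in `B`, of a polynomial computed by a set-multilinear
formula of size `s`; the last of them refers to a formula of size at most `n ^ m`. -/
structure FormulaRankBound (m : ℕ) (B : Finset (Fin d)) (s : ℕ)
    (f : MvPolynomial (Fin d × Fin n) F) : Prop where
  pow_size : HasRankLE B (s ^ B.card) f
  log_saving : B.Nonempty →
    ∃ r, r * n ^ (1 + Nat.log 2 B.card) ≤ s * n ^ B.card ∧ HasRankLE B r f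
  linear_saving : 2 ^ (m + 1) ≤ B.card →
    ∃ r, r * n ^ (B.card ⌈/⌉ 2 ^ (m + 1) + m) ≤ s * n ^ B.card ∧ HasRankLE B r f

namespace FormulaRankBound

variable {m : ℕ} {B B₁ B₂ : Finset (Fin d)} {s s₁ s₂ : ℕ} {f g : MvPolynomial (Fin d × Fin n) F}

theorem mono (hf : FormulaRankBound m B s₁ f) (h : s₁ ≤ s₂) : FormulaRankBound m B s₂ f where
  pow_size := hf.pow_size.mono (Nat.pow_le_pow_left h _)
  log_saving hB := by
    obtain ⟨r, hr, hr'⟩ := hf.log_saving hB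
    exact ⟨r, hr.trans (Nat.mul_le_mul_right _ h), hr'⟩
  linear_saving hB := by
    obtain ⟨r, hr, hr'⟩ := hf.linear_saving hB
    exact ⟨r, hr.trans (Nat.mul_le_mul_right _ h), hr'⟩

theorem zero (B : Finset (Fin d)) :
    FormulaRankBound m B 0 (0 : MvPolynomial (Fin d × Fin n) F) where
  pow_size := (HasRankLE.zero B).mono (Nat.zero_le _)
  log_saving _ := ⟨0, by simp, HasRankLE.zero B⟩
  linear_saving _ := ⟨0, by simp, HasRankLE.zero B⟩

theorem const (s : ℕ) (c : F) :
    FormulaRankBound m ∅ s (MvPolynomial.C c : MvPolynomial (Fin d × Fin n) F) where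
  pow_size := by simpa using HasRankLE.const c
  log_saving h := by simp at h
  linear_saving h := by simp at h

theorem var (i : Fin d) (j : Fin n) :
    FormulaRankBound m {i} 1 (MvPolynomial.X (i, j) : MvPolynomial (Fin d × Fin n) F) where
  pow_size := by simpa using HasRankLE.var i j
  log_saving _ := ⟨1, by simp, HasRankLE.var i j⟩
  linear_saving h := by
    have := Nat.one_lt_two_pow (n := m + 1) (by omega)
    simp only [Finset.card_singleton] at h
    omega

theorem C_mul (hf : FormulaRankBound m B s f) (c : F) :
    FormulaRankBound m B s (MvPolynomial.C c * f) where
  pow_size := hf.pow_size.C_mul c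
  log_saving hB := by
    obtain ⟨r, hr, hr'⟩ := hf.log_saving hB
    exact ⟨r, hr, hr'.C_mul c⟩
  linear_saving hB := by
    obtain ⟨r, hr, hr'⟩ := hf.linear_saving hB
    exact ⟨r, hr, hr'.C_mul c⟩

theorem add (hf : FormulaRankBound m B s₁ f) (hg : FormulaRankBound m B s₂ g) :
    FormulaRankBound m B (s₁ + s₂) (f + g) where
  pow_size := by
    rcases B.eq_empty_or_nonempty with rfl | hB
    -- Adding gives `1 + 1` while `(s₁ + s₂) ^ 0 = 1`; two constants must be merged into one.
    · simpa using (hf.pow_size.add hg.pow_size).trivial_bound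
    · exact (hf.pow_size.add hg.pow_size).mono
        (pow_add_pow_le (Nat.zero_le _) (Nat.zero_le _) hB.card_pos.ne')
  log_saving hB := by
    obtain ⟨r₁, h₁, h₁'⟩ := hf.log_saving hB
    obtain ⟨r₂, h₂, h₂'⟩ := hg.log_saving hB
    exact ⟨r₁ + r₂, by rw [add_mul, add_mul]; exact add_le_add h₁ h₂, h₁'.add h₂'⟩
  linear_saving hB := by
    obtain ⟨r₁, h₁, h₁'⟩ := hf.linear_saving hB
    obtain ⟨r₂, h₂, h₂'⟩ := hg.linear_saving hB
    exact ⟨r₁ + r₂, by rw [add_mul, add_mul]; exact add_le_add h₁ h₂, h₁'.add h₂'⟩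

theorem sum {ι : Type*} (t : Finset ι) (w : ι → F) (s : ι → ℕ)
    (f : ι → MvPolynomial (Fin d × Fin n) F) (h : ∀ l ∈ t, FormulaRankBound m B (s l) (f l)) :
    FormulaRankBound m B (∑ l ∈ t, s l) (∑ l ∈ t, MvPolynomial.C (w l) * f l) := by
  classical
  induction t using Finset.induction_on with
  | empty => simpa using zero B
  | insert x t hx ih =>
    rw [Finset.sum_insert hx, Finset.sum_insert hx]
    exact ((h x (Finset.mem_insert_self _ _)).C_mul _).add
      (ih fun l hl => h l (Finset.mem_insert_of_mem hl))

/-- Adding the smaller factor at most doubles the number of blocks, so `log₂` grows by at most one,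
which the trivial bound on that factor pays for. -/
theorem log_saving_mul (hn : 0 < n) (hB : Disjoint B₁ B₂) (hle : B₂.card ≤ B₁.card)
    (hf : FormulaRankBound m B₁ s₁ f) (hg : FormulaRankBound m B₂ s₂ g) (hne : B₁.Nonempty) :
    ∃ r, r * n ^ (1 + Nat.log 2 (B₁.card + B₂.card)) ≤ s₁ * n ^ (B₁.card + B₂.card) ∧
      HasRankLE (B₁ ∪ B₂) r (f * g) := by
  obtain ⟨r, hr, hr'⟩ := hf.log_saving hne
  refine ⟨_, ?_, hr'.mul hB hg.pow_size.trivial_bound⟩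
  have hexp : B₂.card - 1 + (1 + Nat.log 2 (B₁.card + B₂.card)) ≤
      1 + Nat.log 2 B₁.card + B₂.card := by
    rcases Nat.eq_zero_or_pos B₂.card with h0 | h0
    · simp [h0]
    · have h1 : Nat.log 2 (B₁.card + B₂.card) ≤ Nat.log 2 (B₁.card * 2) :=
        Nat.log_mono_right (by omega)
      rw [Nat.log_mul_base one_lt_two hne.card_pos.ne'] at h1
      omega
  calc r * n ^ (B₂.card - 1) * n ^ (1 + Nat.log 2 (B₁.card + B₂.card))
      = r * n ^ (B₂.card - 1 + (1 + Nat.log 2 (B₁.card + B₂.card))) := by rw [mul_assoc, ← pow_add]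
    _ ≤ r * n ^ (1 + Nat.log 2 B₁.card + B₂.card) :=
        Nat.mul_le_mul_left _ (Nat.pow_le_pow_right hn hexp)
    _ = r * n ^ (1 + Nat.log 2 B₁.card) * n ^ B₂.card := by rw [mul_assoc, ← pow_add]
    _ ≤ s₁ * n ^ B₁.card * n ^ B₂.card := Nat.mul_le_mul_right _ hr
    _ = s₁ * n ^ (B₁.card + B₂.card) := by rw [mul_assoc, ← pow_add]

/-- Fewer than `D` new blocks raise `⌈b / D⌉` by at most one, again paid for by the trivial bound.
-/
theorem linear_saving_mul_small (hn : 0 < n) (hB : Disjoint B₁ B₂)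
    (h₁ : 2 ^ (m + 1) ≤ B₁.card) (h₂ : B₂.card < 2 ^ (m + 1))
    (hf : FormulaRankBound m B₁ s₁ f) (hg : FormulaRankBound m B₂ s₂ g) :
    ∃ r, r * n ^ ((B₁.card + B₂.card) ⌈/⌉ 2 ^ (m + 1) + m) ≤ s₁ * n ^ (B₁.card + B₂.card) ∧
      HasRankLE (B₁ ∪ B₂) r (f * g) := by
  obtain ⟨r, hr, hr'⟩ := hf.linear_saving h₁
  refine ⟨_, ?_, hr'.mul hB hg.pow_size.trivial_bound⟩
  set D := 2 ^ (m + 1) with hD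
  have hexp : B₂.card - 1 + ((B₁.card + B₂.card) ⌈/⌉ D + m) ≤ B₁.card ⌈/⌉ D + m + B₂.card := by
    rcases Nat.eq_zero_or_pos B₂.card with h0 | h0
    · simp [h0]
    · have : (B₁.card + B₂.card) ⌈/⌉ D ≤ B₁.card ⌈/⌉ D + 1 := by
        have hD0 : 0 < D := by positivity
        rw [Nat.ceilDiv_eq_add_pred_div, Nat.ceilDiv_eq_add_pred_div,
          ← Nat.add_div_right _ hD0]
        exact Nat.div_le_div_right (by omega)
      omega
  calc r * n ^ (B₂.card - 1) * n ^ ((B₁.card + B₂.card) ⌈/⌉ D + m)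
      = r * n ^ (B₂.card - 1 + ((B₁.card + B₂.card) ⌈/⌉ D + m)) := by rw [mul_assoc, ← pow_add]
    _ ≤ r * n ^ (B₁.card ⌈/⌉ D + m + B₂.card) :=
        Nat.mul_le_mul_left _ (Nat.pow_le_pow_right hn hexp)
    _ = r * n ^ (B₁.card ⌈/⌉ D + m) * n ^ B₂.card := by rw [mul_assoc, ← pow_add]
    _ ≤ s₁ * n ^ B₁.card * n ^ B₂.card := Nat.mul_le_mul_right _ hr
    _ = s₁ * n ^ (B₁.card + B₂.card) := by rw [mul_assoc, ← pow_add]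

/-- The ceiling is subadditive, and the savings multiply to contain `n ^ m` twice: one copy cancels
`s₂`, the other remains. -/
theorem linear_saving_mul_large (hn : 0 < n) (hB : Disjoint B₁ B₂)
    (h₁ : 2 ^ (m + 1) ≤ B₁.card) (h₂ : 2 ^ (m + 1) ≤ B₂.card) (hs : s₂ ≤ n ^ m)
    (hf : FormulaRankBound m B₁ s₁ f) (hg : FormulaRankBound m B₂ s₂ g) :
    ∃ r, r * n ^ ((B₁.card + B₂.card) ⌈/⌉ 2 ^ (m + 1) + m) ≤ s₁ * n ^ (B₁.card + B₂.card) ∧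
      HasRankLE (B₁ ∪ B₂) r (f * g) := by
  obtain ⟨r₁, hr₁, hr₁'⟩ := hf.linear_saving h₁
  obtain ⟨r₂, hr₂, hr₂'⟩ := hg.linear_saving h₂
  refine ⟨_, ?_, hr₁'.mul hB hr₂'⟩
  set D := 2 ^ (m + 1) with hD
  have hD0 : 0 < D := by positivity
  have hexp : (B₁.card + B₂.card) ⌈/⌉ D ≤ B₁.card ⌈/⌉ D + B₂.card ⌈/⌉ D := by
    rw [ceilDiv_le_iff_le_mul hD0, mul_add]
    exact add_le_add (le_smul_ceilDiv hD0) (le_smul_ceilDiv hD0)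
  refine Nat.le_of_mul_le_mul_right ?_ (pow_pos hn m)
  calc r₁ * r₂ * n ^ ((B₁.card + B₂.card) ⌈/⌉ D + m) * n ^ m
      ≤ r₁ * r₂ * n ^ (B₁.card ⌈/⌉ D + B₂.card ⌈/⌉ D + m) * n ^ m := by
        gcongr
    _ = r₁ * n ^ (B₁.card ⌈/⌉ D + m) * (r₂ * n ^ (B₂.card ⌈/⌉ D + m)) := by ring
    _ ≤ s₁ * n ^ B₁.card * (s₂ * n ^ B₂.card) := Nat.mul_le_mul hr₁ hr₂
    _ ≤ s₁ * n ^ B₁.card * (n ^ m * n ^ B₂.card) := by gcongr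
    _ = s₁ * n ^ (B₁.card + B₂.card) * n ^ m := by ring

theorem mul (hn : 0 < n) (hB : Disjoint B₁ B₂) (hs : s₁ + s₂ ≤ n ^ m)
    (hf : FormulaRankBound m B₁ s₁ f) (hg : FormulaRankBound m B₂ s₂ g) :
    FormulaRankBound m (B₁ ∪ B₂) (s₁ + s₂) (f * g) := by
  have hlog : (B₁ ∪ B₂).Nonempty → ∃ r, r * n ^ (1 + Nat.log 2 (B₁ ∪ B₂).card) ≤
      (s₁ + s₂) * n ^ (B₁ ∪ B₂).card ∧ HasRankLE (B₁ ∪ B₂) r (f * g) := by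
    intro hne
    have hpos := hne.card_pos
    rw [Finset.card_union_of_disjoint hB] at hpos ⊢
    rcases le_total B₂.card B₁.card with hle | hle
    · obtain ⟨r, hr, hr'⟩ := log_saving_mul hn hB hle hf hg (Finset.card_pos.1 (by omega))
      exact ⟨r, hr.trans (Nat.mul_le_mul_right _ (by omega)), hr'⟩
    · obtain ⟨r, hr, hr'⟩ := log_saving_mul hn hB.symm hle hg hf (Finset.card_pos.1 (by omega))
      rw [add_comm B₂.card] at hr
      rw [Finset.union_comm, mul_comm g] at hr'
      exact ⟨r, hr.trans (Nat.mul_le_mul_right _ (by omega)), hr'⟩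
  refine ⟨?_, hlog, fun hD => ?_⟩
  · refine (hf.pow_size.mul hB hg.pow_size).mono ?_
    rw [Finset.card_union_of_disjoint hB, pow_add]
    gcongr <;> omega
  have hD0 : 0 < 2 ^ (m + 1) := by positivity
  have hlog' := hlog (Finset.card_pos.1 (hD0.trans_le hD))
  rw [Finset.card_union_of_disjoint hB] at hD hlog' ⊢
  rcases le_or_gt (2 ^ (m + 1)) B₁.card with h₁ | h₁ <;>
    rcases le_or_gt (2 ^ (m + 1)) B₂.card with h₂ | h₂
  · obtain ⟨r, hr, hr'⟩ := linear_saving_mul_large hn hB h₁ h₂ (by omega) hf hg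
    exact ⟨r, hr.trans (Nat.mul_le_mul_right _ (by omega)), hr'⟩
  · obtain ⟨r, hr, hr'⟩ := linear_saving_mul_small hn hB h₁ h₂ hf hg
    exact ⟨r, hr.trans (Nat.mul_le_mul_right _ (by omega)), hr'⟩
  · obtain ⟨r, hr, hr'⟩ := linear_saving_mul_small hn hB.symm h₂ h₁ hg hf
    rw [add_comm B₂.card] at hr
    rw [Finset.union_comm, mul_comm g] at hr'
    exact ⟨r, hr.trans (Nat.mul_le_mul_right _ (by omega)), hr'⟩
  -- Here `D ≤ b < 2 * D`, so the target saving is at most `2 + m`, and the logarithmic one is at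
  -- least `1 + (m + 1)`.
  · obtain ⟨r, hr, hr'⟩ := hlog'
    refine ⟨r, le_trans (Nat.mul_le_mul_left _ (Nat.pow_le_pow_right hn ?_)) hr, hr'⟩
    have hc : (B₁.card + B₂.card) ⌈/⌉ 2 ^ (m + 1) ≤ 2 := by
      rw [ceilDiv_le_iff_le_mul hD0]
      omega
    have hl : m + 1 ≤ Nat.log 2 (B₁.card + B₂.card) := Nat.le_log_of_pow_le one_lt_two hD
    omega

theorem prod {ι : Type*} (hn : 0 < n) (t : Finset ι) (B : ι → Finset (Fin d)) (s : ι → ℕ)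
    (f : ι → MvPolynomial (Fin d × Fin n) F) (hB : (t : Set ι).PairwiseDisjoint B)
    (hs : ∑ l ∈ t, s l ≤ n ^ m) (h : ∀ l ∈ t, FormulaRankBound m (B l) (s l) (f l)) :
    FormulaRankBound m (t.biUnion B) (∑ l ∈ t, s l) (∏ l ∈ t, f l) := by
  classical
  induction t using Finset.induction_on with
  | empty => simpa using const (n := n) (d := d) (m := m) 0 (1 : F)
  | insert x t hx ih =>
    rw [Finset.sum_insert hx] at hs ⊢
    rw [Finset.prod_insert hx, Finset.biUnion_insert]
    refine mul hn ?_ hs (h x (Finset.mem_insert_self _ _))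
      (ih (hB.subset (by simp)) (by omega) fun l hl => h l (Finset.mem_insert_of_mem hl))
    rw [Finset.disjoint_biUnion_right]
    intro l hl
    exact hB (by simp) (by simp [hl]) fun h => hx (h ▸ hl)

end FormulaRankBound

end SetMultilinear

/-! ### Set-multilinear formulas -/

namespace ArithFormula

open SetMultilinear

variable {F : Type u} {d n : ℕ}

theorem one_le_size (Φ : ArithFormula F d n) : 1 ≤ Φ.size := by
  cases Φ <;> simp [size]

theorem degree_le_card_blocks (Φ : ArithFormula F d n) (h : Φ.IsSetMultilinear) :
    Φ.degree ≤ Φ.blocks.card := by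
  induction Φ with
  | const a => simp [degree]
  | var i j => simp [degree, blocks]
  | sum k w child ih =>
    refine Finset.sup_le fun l _ => (ih l (h.1 l)).trans (Finset.card_le_card ?_)
    exact Finset.subset_biUnion_of_mem (fun l => (child l).blocks) (Finset.mem_univ l)
  | prod k child ih =>
    simp only [degree, blocks]
    rw [Finset.card_biUnion fun l _ l' _ hll => h.2 l l' hll]
    exact Finset.sum_le_sum fun l _ => ih l (h.1 l)

variable [Field F]

theorem isHomogeneous_eval (Φ : ArithFormula F d n) (h : Φ.IsSetMultilinear) :
    Φ.eval.IsHomogeneous Φ.degree := by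
  induction Φ with
  | const a => exact MvPolynomial.isHomogeneous_C _ _
  | var i j => exact MvPolynomial.isHomogeneous_X _ _
  | sum k w child ih =>
    refine MvPolynomial.IsHomogeneous.sum _ _ _ fun l _ => ?_
    have hdeg : (sum k w child).degree = (child l).degree :=
      le_antisymm (Finset.sup_le fun l' _ => (h.2 l' l).le)
        (Finset.le_sup (f := fun l => (child l).degree) (Finset.mem_univ l))
    rw [hdeg]
    exact (ih l (h.1 l)).C_mul _
  | prod k child ih =>
    exact MvPolynomial.IsHomogeneous.prod _ _ _ fun l _ => ih l (h.1 l)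

/-- Equality of degree and number of blocks passes down to children: at a sum it forces every child
to use all the blocks, and at a product the inequalities degree ≤ blocks add up to an equality, so
each is one. -/
theorem formulaRankBound {m : ℕ} (hn : 0 < n) (Φ : ArithFormula F d n) (h : Φ.IsSetMultilinear)
    (hdeg : Φ.degree = Φ.blocks.card) (hs : Φ.size ≤ n ^ m) :
    FormulaRankBound m Φ.blocks Φ.size Φ.eval := by
  induction Φ with
  | const a => exact FormulaRankBound.const 1 a
  | var i j => exact FormulaRankBound.var i j
  | sum k w child ih =>
    simp only [size] at hs ⊢
    refine (FormulaRankBound.sum Finset.univ w (fun l => (child l).size)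
      (fun l => (child l).eval) fun l _ => ?_).mono (Nat.le_add_left _ _)
    have hle : (sum k w child).degree ≤ (child l).degree :=
      Finset.sup_le fun l' _ => (h.2 l' l).le
    have hsub : (child l).blocks ⊆ (sum k w child).blocks :=
      Finset.subset_biUnion_of_mem (fun l => (child l).blocks) (Finset.mem_univ l)
    have hcard := (child l).degree_le_card_blocks (h.1 l)
    have heq : (child l).blocks = (sum k w child).blocks :=
      Finset.eq_of_subset_of_card_le hsub (by omega)
    have hsize := Finset.single_le_sum (f := fun l => (child l).size)
      (fun _ _ => Nat.zero_le _) (Finset.mem_univ l)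
    rw [← heq] at hdeg ⊢
    exact ih l (h.1 l) (by omega) (by omega)
  | prod k child ih =>
    simp only [size] at hs ⊢
    refine (FormulaRankBound.prod hn Finset.univ (fun l => (child l).blocks)
      (fun l => (child l).size) (fun l => (child l).eval) (fun l _ l' _ hll => h.2 l l' hll)
      (by omega) fun l hl => ?_).mono (Nat.le_add_left _ _)
    simp only [degree, blocks] at hdeg
    rw [Finset.card_biUnion fun l _ l' _ hll => h.2 l l' hll] at hdeg
    have heq := (Finset.sum_eq_sum_iff_of_le
      fun l _ => (child l).degree_le_card_blocks (h.1 l)).1 hdeg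
    have hsize := Finset.single_le_sum (f := fun l => (child l).size)
      (fun _ _ => Nat.zero_le _) hl
    exact ih l (h.1 l) (heq l hl) (by omega)

end ArithFormula

namespace SetMultilinear

variable {F : Type u} [Field F] {d n : ℕ}

theorem tensorRank_zero : tensorRank (0 : MvPolynomial (Fin d × Fin n) F) = 0 :=
  Nat.le_zero.1 (Nat.sInf_le ⟨fun _ _ _ => 0, by simp⟩)

theorem IsSetMultilinearPoly.eq_of_isHomogeneous {f : MvPolynomial (Fin d × Fin n) F} {e : ℕ}
    (hf : IsSetMultilinearPoly f) (hhom : f.IsHomogeneous e) (h0 : f ≠ 0) : e = d := by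
  obtain ⟨m, hm⟩ := MvPolynomial.support_nonempty.2 h0
  have h1 := hhom (MvPolynomial.mem_support_iff.1 hm)
  rw [Finsupp.weight_apply, Finsupp.sum_fintype _ _ (by simp), Fintype.sum_prod_type] at h1
  simp only [Pi.one_apply, smul_eq_mul, mul_one] at h1
  rw [← h1, Finset.sum_congr rfl fun i _ => hf m hm i]
  simp

end SetMultilinear

/-! ### Bounds at the output and the choice of `K` -/

open ArithFormula SetMultilinear in
theorem ArithFormula.tensorRank_bounds {F : Type u} [Field F] {d n m : ℕ} (Φ : ArithFormula F d n)
    (hn : 0 < n) (hd : 0 < d) (hΦ : Φ.IsSetMultilinear) (hf : IsSetMultilinearPoly Φ.eval)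
    (hs : Φ.size ≤ n ^ m) :
    tensorRank Φ.eval ≤ Φ.size ^ d ∧
      tensorRank Φ.eval * n ^ (d ⌈/⌉ 2 ^ (m + 1)) ≤ n ^ d := by
  -- If the output is zero, its syntactic degree need not be `d`.
  by_cases h0 : Φ.eval = 0
  · rw [h0, tensorRank_zero]
    simp
  have hdeg := hf.eq_of_isHomogeneous (Φ.isHomogeneous_eval hΦ) h0
  have hle := Φ.degree_le_card_blocks hΦ
  have huniv : Φ.blocks = Finset.univ :=
    Finset.eq_univ_of_card _ (le_antisymm (Finset.card_le_univ _) (by simpa [← hdeg] using hle))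
  have hbound := Φ.formulaRankBound hn hΦ (by rw [huniv, hdeg]; simp) hs
  rw [huniv] at hbound
  obtain ⟨hpow, -, hlin⟩ := hbound
  rw [Finset.card_univ, Fintype.card_fin] at hpow hlin
  refine ⟨hpow.tensorRank_le hd, ?_⟩
  rcases le_or_gt (2 ^ (m + 1)) d with h | h
  · obtain ⟨r, hr, hr'⟩ := hlin h
    refine (Nat.mul_le_mul_right _ (hr'.tensorRank_le hd)).trans ?_
    refine Nat.le_of_mul_le_mul_right ?_ (pow_pos hn m)
    calc r * n ^ (d ⌈/⌉ 2 ^ (m + 1)) * n ^ m = r * n ^ (d ⌈/⌉ 2 ^ (m + 1) + m) := by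
          rw [mul_assoc, ← pow_add]
      _ ≤ Φ.size * n ^ d := hr
      _ ≤ n ^ m * n ^ d := Nat.mul_le_mul_right _ hs
      _ = n ^ d * n ^ m := mul_comm _ _
  · have hc : d ⌈/⌉ 2 ^ (m + 1) ≤ 1 := by
      rw [ceilDiv_le_iff_le_mul (by positivity)]
      omega
    have ht := hpow.trivial_bound.tensorRank_le hd
    rw [Finset.card_univ, Fintype.card_fin] at ht
    calc _ ≤ n ^ (d - 1) * n ^ 1 := Nat.mul_le_mul ht (Nat.pow_le_pow_right hn hc)
      _ = n ^ d := by rw [← pow_add, Nat.sub_add_cancel hd]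

/-- Since `5 * log 2 > 3`, the power is at least `1 + 3 * c`, and `(1 + 3 * c) * (1 - c) ≥ 1` for `0
≤ c ≤ 2/3`. -/
theorem add_inv_two_rpow_le_one {c : ℝ} (h0 : 0 < c) (h1 : c < 1 / 2) :
    c + ((2 : ℝ) ^ (5 * c))⁻¹ ≤ 1 := by
  have hlog := Real.log_two_gt_d9
  have h : 1 + 3 * c ≤ (2 : ℝ) ^ (5 * c) := by
    rw [Real.rpow_def_of_pos two_pos]
    refine le_trans ?_ (Real.add_one_le_exp _)
    nlinarith
  have h2 : ((2 : ℝ) ^ (5 * c))⁻¹ ≤ (1 + 3 * c)⁻¹ := by gcongr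
  have h3 : (1 + 3 * c)⁻¹ ≤ 1 - c := by
    rw [inv_le_iff_one_le_mul₀ (by linarith)]
    nlinarith
  linarith

theorem mainTheorem4 :
    ∃ K : ℝ, 0 < K ∧
      ∀ (F : Type u) [Field F] (d n : ℕ) (c : ℝ) (Φ : ArithFormula F d n),
        0 < d → 0 < c →
        Φ.IsSetMultilinear →
        SetMultilinear.IsSetMultilinearPoly Φ.eval →
        (Φ.size : ℝ) ≤ (n : ℝ) ^ c →
        (SetMultilinear.tensorRank Φ.eval : ℝ) ≤
          (n : ℝ) ^ d / (n : ℝ) ^ ((d : ℝ) / (2 : ℝ) ^ (K * c)) := by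
  refine ⟨5, by norm_num, fun F _ d n c Φ hd hc hΦ hf hs => ?_⟩
  have hn : 0 < n := by
    rcases Nat.eq_zero_or_pos n with rfl | h
    · have h1 : (1 : ℝ) ≤ Φ.size := by exact_mod_cast Φ.one_le_size
      rw [Nat.cast_zero, Real.zero_rpow hc.ne'] at hs
      linarith
    · exact h
  have hn0 : (0 : ℝ) < n := by exact_mod_cast hn
  have hn1 : (1 : ℝ) ≤ n := by exact_mod_cast hn
  have hsm : Φ.size ≤ n ^ ⌈c⌉₊ := by
    have : (Φ.size : ℝ) ≤ (n : ℝ) ^ (⌈c⌉₊ : ℝ) :=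
      hs.trans (Real.rpow_le_rpow_of_exponent_le hn1 (Nat.le_ceil c))
    rw [Real.rpow_natCast] at this
    exact_mod_cast this
  obtain ⟨hpow, hlin⟩ := Φ.tensorRank_bounds hn hd hΦ hf hsm
  rw [le_div_iff₀ (by positivity)]
  rcases lt_or_ge c (1 / 2) with hc2 | hc2
  · have h1 : (SetMultilinear.tensorRank Φ.eval : ℝ) ≤ (n : ℝ) ^ (c * d) := by
      rw [Real.rpow_mul hn0.le, Real.rpow_natCast]
      calc (SetMultilinear.tensorRank Φ.eval : ℝ) ≤ (Φ.size : ℝ) ^ d := by exact_mod_cast hpow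
        _ ≤ _ := by gcongr
    calc _ ≤ (n : ℝ) ^ (c * d) * (n : ℝ) ^ ((d : ℝ) / (2 : ℝ) ^ (5 * c)) := by gcongr
      _ = (n : ℝ) ^ ((c + ((2 : ℝ) ^ (5 * c))⁻¹) * d) := by
        rw [← Real.rpow_add hn0]
        congr 1
        ring
      _ ≤ (n : ℝ) ^ (d : ℝ) := by
        refine Real.rpow_le_rpow_of_exponent_le hn1 ?_
        exact mul_le_of_le_one_left (by positivity) (add_inv_two_rpow_le_one hc hc2)
      _ = (n : ℝ) ^ d := Real.rpow_natCast _ _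
  · have hexp : (d : ℝ) / (2 : ℝ) ^ (5 * c) ≤ (d ⌈/⌉ 2 ^ (⌈c⌉₊ + 1) : ℕ) := by
      -- `⌈c⌉ + 1 < c + 2 ≤ 5 * c`, the last step because `c ≥ 1/2`.
      have h1 : ((2 : ℝ) ^ (⌈c⌉₊ + 1)) ≤ (2 : ℝ) ^ (5 * c) := by
        rw [← Real.rpow_natCast]
        refine Real.rpow_le_rpow_of_exponent_le one_le_two ?_
        have := Nat.ceil_lt_add_one hc.le
        push_cast
        linarith
      have h2 : (d : ℝ) ≤ (2 : ℝ) ^ (⌈c⌉₊ + 1) * (d ⌈/⌉ 2 ^ (⌈c⌉₊ + 1) : ℕ) := by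
        have := le_smul_ceilDiv (a := 2 ^ (⌈c⌉₊ + 1)) (by positivity) (b := d)
        rw [smul_eq_mul] at this
        exact_mod_cast this
      rw [div_le_iff₀ (by positivity), mul_comm]
      exact h2.trans (by gcongr)
    calc _ ≤ (SetMultilinear.tensorRank Φ.eval : ℝ) * (n : ℝ) ^ (d ⌈/⌉ 2 ^ (⌈c⌉₊ + 1)) := by
          rw [← Real.rpow_natCast]
          gcongr
      _ ≤ (n : ℝ) ^ d := by exact_mod_cast hlin
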